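/- Let $\mathcal{G}$ be a directed acyclic graph whose node set is the disjoint union of a set $\mathbf{X}$ of measured covariates, a set $\mathbf{U}$ of unmeasured (latent) nodes, and $\{W, Y\}$, where the treatment $W$ and the outcome $Y \neq W$ are measured. Suppose that $\mathcal{G}$ contains the edge $W\rightarrow Y$ and that there is a node $U\in\mathbf{U}$ with edges $W\leftarrow U\rightarrow Y$. Paths are sequences of pairwise distinct nodes in which consecutive nodes are adjacent, and every node counts as an ancestor and a descendant of itself. Let $\mathcal{M}$ be the maximal ancestral graph (MAG) over $\mathbf{X}\cup\{W,Y\}$ mapped from $\mathcal{G}$: two distinct measured nodes $A, B$ are adjacent in $\mathcal{M}$ if and only if $\mathcal{G}$ contains an inducing path between them relative to $\mathbf{U}$, i.e. a path between $A$ and $B$ on which every non-endpoint node is in $\mathbf{U}$ or is a collider on the path, and every collider is an ancestor in $\mathcal{G}$ of $A$ or of $B$; if $A, B$ are adjacent in $\mathcal{M}$, the edge is $A\rightarrow B$ if $A$ is an ancestor of $B$ in $\mathcal{G}$, $A\leftarrow B$ if $B$ is an ancestor of $A$ in $\mathcal{G}$, and $A\leftrightarrow B$ otherwise. Let $Adj(Y)$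 denote the set of nodes that are adjacent to $Y$ in $\mathcal{M}$. A node $S\in\mathbf{X}$ is an ancestral instrumental variable (AIV) with respect to $W\rightarrow Y$ if there is a set $\mathbf{Z}\subseteq\mathbf{X}\setminus\{S\}$ such that (i) $S$ and $W$ are not d-separated by $\mathbf{Z}$ in $\mathcal{G}$; (ii) $S$ and $Y$ are d-separated by $\mathbf{Z}$ in the graph obtained from $\mathcal{G}$ by removing the edge $W\rightarrow Y$; and (iii) every element of $\mathbf{Z}$ is an ancestor of $Y$ or of $S$ in $\mathcal{G}$, and none is a descendant of $Y$ in $\mathcal{G}$. An AIV $S$ is direct if it is adjacent to $W$ in $\mathcal{G}$. If $S$ is a direct AIV in $\mathcal{G}$, then $S\in Adj(Y)\setminus\{W\}$ in $\mathcal{M}$. -/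

import Mathlib

/-! ### Directed graphs: ancestors, colliders, paths, d-separation -/

namespace Digraph

variable {V : Type*}

/-- `a` is an ancestor of `b` (and `b` is a descendant of `a`): there is a directed path from `a`
to `b`. The path of length zero is allowed, so every node is an ancestor of itself. -/
def IsAncestor (G : Digraph V) (a b : V) : Prop :=
  Relation.ReflTransGen G.Adj a b

/-- There is no directed cycle (in particular, no loop). -/
def IsAcyclic (G : Digraph V) : Prop :=
  ∀ v, ¬ Relation.TransGen G.Adj v v

/-- The underlying undirected graph: two distinct nodes are adjacent if there is an edge between
them in one of the two directions. Paths in `G` are paths (sequences of pairwise distinct nodes)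
in this graph. -/
abbrev skeleton (G : Digraph V) : SimpleGraph V :=
  G.toSimpleGraphInclusive

/-- `u → v ← w`. -/
def IsCollider (G : Digraph V) (u v w : V) : Prop :=
  G.Adj u v ∧ G.Adj w v

/-- A path is blocked by `Z` if it contains a chain or a fork whose middle node is in `Z`, or a
collider `u → v ← w` such that neither `v` nor any descendant of `v` is in `Z`. -/
def IsBlocked (G : Digraph V) {a b : V} (p : G.skeleton.Walk a b) (Z : Set V) : Prop :=
  ∃ u v w, [u, v, w] <:+: p.support ∧
    ((¬ G.IsCollider u v w ∧ v ∈ Z) ∨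
      (G.IsCollider u v w ∧ ∀ d, G.IsAncestor v d → d ∉ Z))

/-- `Z` d-separates `a` from `b`: it blocks every path between them. -/
def DSep (G : Digraph V) (a b : V) (Z : Set V) : Prop :=
  ∀ p : G.skeleton.Walk a b, p.IsPath → G.IsBlocked p Z

/-- The graph obtained by removing the edge `a → b`. -/
def removeEdge (G : Digraph V) (a b : V) : Digraph V where
  Adj u v := G.Adj u v ∧ ¬ (u = a ∧ v = b)

/-- A path between `a` and `b` is inducing relative to the set `L` of latent nodes if every
non-endpoint node on it is in `L` or is a collider on it, and every collider on it is an ancestor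
of `a` or of `b`. -/
def IsInducingPath (G : Digraph V) (L : Set V) {a b : V} (p : G.skeleton.Walk a b) : Prop :=
  p.IsPath ∧ ∀ u v w, [u, v, w] <:+: p.support →
    (v ∈ L ∨ G.IsCollider u v w) ∧
    (G.IsCollider u v w → G.IsAncestor v a ∨ G.IsAncestor v b)

end Digraph

/-! ### Mixed graphs and the MAG mapped from a DAG -/

/-- A graph with directed edges (`dir a b` is `a → b`) and bidirected edges (`bidir a b` is
`a ↔ b`), without loops and with at most one edge between any two nodes. -/
structure MixedGraph (V : Type*) where
  dir : V → V → Prop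
  bidir : V → V → Prop
  bidir_symm : ∀ a b, bidir a b → bidir b a
  dir_irrefl : ∀ a, ¬ dir a a
  bidir_irrefl : ∀ a, ¬ bidir a a
  dir_asymm : ∀ a b, dir a b → ¬ dir b a
  dir_not_bidir : ∀ a b, dir a b → ¬ bidir a b

/-- `Adj(v)`: the set of all nodes that are joined to `v` by an edge of any kind. -/
def MixedGraph.adj {V : Type*} (M : MixedGraph V) (v : V) : Set V :=
  {a | M.dir a v ∨ M.dir v a ∨ M.bidir a v}

/-- A directed acyclic graph whose node set is the disjoint union of the measured covariates `X`,
the unmeasured nodes `U`, the treatment `W` and the outcome `Y`. -/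
structure LatentDAG (V : Type*) where
  graph : Digraph V
  acyclic : graph.IsAcyclic
  X : Set V
  U : Set V
  W : V
  Y : V
  cover : X ∪ U ∪ {W, Y} = Set.univ
  disjoint_X_U : Disjoint X U
  W_notMem : W ∉ X ∪ U
  Y_notMem : Y ∉ X ∪ U
  W_ne_Y : W ≠ Y

namespace LatentDAG

variable {V : Type*} (D : LatentDAG V)

/-- The measured nodes. -/
def measured : Set V := D.X ∪ {D.W, D.Y}

/-- The treatment as a measured node. -/
def treatment : D.measured := ⟨D.W, Or.inr (Or.inl rfl)⟩

/-- The outcome as a measured node. -/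
def outcome : D.measured := ⟨D.Y, Or.inr (Or.inr rfl)⟩

/-- There is an inducing path between `a` and `b` relative to the unmeasured nodes. -/
def HasInducingPath (a b : V) : Prop :=
  ∃ p : D.graph.skeleton.Walk a b, D.graph.IsInducingPath D.U p

theorem HasInducingPath.symm {a b : V} (h : D.HasInducingPath a b) : D.HasInducingPath b a := by
  obtain ⟨p, hp, h⟩ := h
  refine ⟨p.reverse, hp.reverse, fun u v w huvw => ?_⟩
  have h' : [w, v, u] <:+: p.support := by
    rw [SimpleGraph.Walk.support_reverse] at huvw
    simpa using List.reverse_infix.mpr huvw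
  obtain ⟨h1, h2⟩ := h w v u h'
  exact ⟨h1.imp_right And.symm, fun hc => (h2 hc.symm).symm⟩

theorem ancestor_antisymm {a b : V} (hab : D.graph.IsAncestor a b)
    (hba : D.graph.IsAncestor b a) : a = b := by
  rcases Relation.reflTransGen_iff_eq_or_transGen.mp hab with h | h
  · exact h.symm
  · exact absurd (h.trans_left hba) (D.acyclic a)

/-- The maximal ancestral graph over the measured nodes to which the DAG is mapped: two distinct
measured nodes are adjacent iff there is an inducing path between them relative to the unmeasured
nodes; an edge between `a` and `b` is `a → b` if `a` is an ancestor of `b` in the DAG, `a ← b` if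
`b` is an ancestor of `a`, and `a ↔ b` otherwise. -/
def mag : MixedGraph D.measured where
  dir a b := a ≠ b ∧ D.HasInducingPath a b ∧ D.graph.IsAncestor a b
  bidir a b := a ≠ b ∧ D.HasInducingPath a b ∧
    ¬ D.graph.IsAncestor a b ∧ ¬ D.graph.IsAncestor b a
  bidir_symm := fun _ _ h => ⟨h.1.symm, HasInducingPath.symm D h.2.1, h.2.2.2, h.2.2.1⟩
  dir_irrefl := fun _ h => h.1 rfl
  bidir_irrefl := fun _ h => h.1 rfl
  dir_asymm := fun _ _ h h' => h.1 (Subtype.ext (D.ancestor_antisymm h.2.2 h'.2.2))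
  dir_not_bidir := fun _ _ h h' => h'.2.2.1 h.2.2

/-- `S` is an ancestral instrumental variable with respect to `W → Y`. -/
def IsAIV (S : V) : Prop :=
  S ∈ D.X ∧ ∃ Z : Set V, Z ⊆ D.X \ {S} ∧
    ¬ D.graph.DSep S D.W Z ∧
    (D.graph.removeEdge D.W D.Y).DSep S D.Y Z ∧
    (∀ z ∈ Z, D.graph.IsAncestor z D.Y ∨ D.graph.IsAncestor z S) ∧
    (∀ z ∈ Z, ¬ D.graph.IsAncestor D.Y z)

/-- A direct ancestral instrumental variable: an ancestral instrumental variable that is adjacent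
to the treatment in the DAG. -/
def IsDirectAIV (S : V) : Prop :=
  D.IsAIV S ∧ D.graph.skeleton.Adj S D.W

end LatentDAG

/-! Everything happens on the four nodes `S`, `W`, `u`, `Y`, where `u` is the latent confounder of
`W` and `Y`; the orientation of the edge between `S` and `W` decides. If `S → W`, then `W` is a
collider on `S → W ← u → Y` and an ancestor of `Y`, so this path is inducing
(`hasInducingPath_outcome`). If `W → S`, then `S ← W ← u → Y` has no collider and avoids the edge `W
→ Y`. Its inner nodes lie outside `X`, hence outside `Z`, so it stays open and contradicts the
separation of `S` from `Y` (`not_dSep_removeEdge_of_adj`). -/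

theorem List.infix_three_of_four {α : Type*} {a b c d u v w : α}
    (h : [u, v, w] <:+: [a, b, c, d]) :
    (u = a ∧ v = b ∧ w = c) ∨ (u = b ∧ v = c ∧ w = d) := by
  simpa [List.infix_cons_iff, List.cons_prefix_cons] using h

namespace LatentDAG

variable {V : Type*} (D : LatentDAG V)

theorem ne_of_adj {a b : V} (h : D.graph.Adj a b) : a ≠ b := by
  rintro rfl
  exact D.acyclic a (.single h)

theorem not_adj_of_adj {a b : V} (h : D.graph.Adj a b) : ¬ D.graph.Adj b a :=
  fun h' => D.acyclic a (.tail (.single h) h')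

/-- A cause of the treatment is joined to the outcome by the inducing path `s → W ← u → Y`. -/
theorem hasInducingPath_outcome {s u : V} (hsu : s ≠ u) (hsY : s ≠ D.Y) (hu : u ∈ D.U)
    (hWY : D.graph.Adj D.W D.Y) (hsW : D.graph.Adj s D.W) (huW : D.graph.Adj u D.W)
    (huY : D.graph.Adj u D.Y) : D.HasInducingPath s D.Y := by
  have h1 : D.graph.skeleton.Adj s D.W := ⟨D.ne_of_adj hsW, Or.inl hsW⟩
  have h2 : D.graph.skeleton.Adj D.W u := ⟨(D.ne_of_adj huW).symm, Or.inr huW⟩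
  have h3 : D.graph.skeleton.Adj u D.Y := ⟨D.ne_of_adj huY, Or.inl huY⟩
  refine ⟨.cons h1 (.cons h2 (.cons h3 .nil)), ?_, fun a b c h => ?_⟩
  · simp [SimpleGraph.Walk.isPath_def, h1.1, h2.1, h3.1, hsu, hsY, D.W_ne_Y]
  · rcases List.infix_three_of_four h with ⟨rfl, rfl, rfl⟩ | ⟨rfl, rfl, rfl⟩
    -- The edge `W → Y` itself makes the collider `W` an ancestor of an endpoint.
    · exact ⟨Or.inr ⟨hsW, huW⟩, fun _ => Or.inr (.single hWY)⟩
    · exact ⟨Or.inl hu, fun hc => absurd hc.1 (D.not_adj_of_adj huW)⟩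

/-- An effect of the treatment is joined to the outcome by the path `s ← W ← u → Y`, which only
sets containing `W` or `u` block, even after the removal of `W → Y`. -/
theorem not_dSep_removeEdge_of_adj {s u : V} {Z : Set V} (hsu : s ≠ u) (hsY : s ≠ D.Y)
    (hWZ : D.W ∉ Z) (huZ : u ∉ Z) (hWs : D.graph.Adj D.W s) (huW : D.graph.Adj u D.W)
    (huY : D.graph.Adj u D.Y) : ¬ (D.graph.removeEdge D.W D.Y).DSep s D.Y Z := by
  intro hsep
  -- All three edges survive the removal, since none of them is `W → Y`.
  have h1 : (D.graph.removeEdge D.W D.Y).skeleton.Adj s D.W :=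
    ⟨(D.ne_of_adj hWs).symm, Or.inr ⟨hWs, fun h => hsY h.2⟩⟩
  have h2 : (D.graph.removeEdge D.W D.Y).skeleton.Adj D.W u :=
    ⟨(D.ne_of_adj huW).symm, Or.inr ⟨huW, fun h => D.W_ne_Y h.2⟩⟩
  have h3 : (D.graph.removeEdge D.W D.Y).skeleton.Adj u D.Y :=
    ⟨D.ne_of_adj huY, Or.inl ⟨huY, fun h => D.ne_of_adj huW h.1⟩⟩
  obtain ⟨a, b, c, h, hb⟩ := hsep (.cons h1 (.cons h2 (.cons h3 .nil))) (by
    simp [SimpleGraph.Walk.isPath_def, h1.1, h2.1, h3.1, hsu, hsY, D.W_ne_Y])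
  rcases List.infix_three_of_four h with ⟨rfl, rfl, rfl⟩ | ⟨rfl, rfl, rfl⟩
  -- A collider at `W` would need `s → W`, a 2-cycle with `W → s`; likewise at `u` below.
  · exact hb.elim (fun h => hWZ h.2) fun h => D.not_adj_of_adj hWs h.1.1.1
  · exact hb.elim (fun h => huZ h.2) fun h => D.not_adj_of_adj huW h.1.1.1

theorem mem_mag_adj_of_hasInducingPath {a b : D.measured} (hne : a ≠ b)
    (h : D.HasInducingPath a b) : a ∈ D.mag.adj b := by
  by_cases hab : D.graph.IsAncestor a b
  · exact Or.inl ⟨hne, h, hab⟩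
  by_cases hba : D.graph.IsAncestor b a
  · exact Or.inr (Or.inl ⟨hne.symm, HasInducingPath.symm D h, hba⟩)
  · exact Or.inr (Or.inr ⟨hne, h, hab, hba⟩)

end LatentDAG

theorem mainTheorem2 {V : Type*} (D : LatentDAG V)
    (hWY : D.graph.Adj D.W D.Y)
    (hU : ∃ u ∈ D.U, D.graph.Adj u D.W ∧ D.graph.Adj u D.Y)
    (S : D.measured) (hS : D.IsDirectAIV S) :
    S ∈ D.mag.adj D.outcome \ {D.treatment} := by
  obtain ⟨u, hu, huW, huY⟩ := hU
  obtain ⟨⟨hSX, Z, hZ, -, hsep, -, -⟩, hne, hadj⟩ := hS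
  have hSY : (S : V) ≠ D.Y := fun h => D.Y_notMem (Or.inl (h ▸ hSX))
  have hSu : (S : V) ≠ u := fun h => D.disjoint_X_U.notMem_of_mem_left hSX (h ▸ hu)
  refine ⟨?_, fun h => hne (congrArg Subtype.val h)⟩
  rcases hadj with hSW | hWS
  · exact D.mem_mag_adj_of_hasInducingPath (fun h => hSY (congrArg Subtype.val h))
      (D.hasInducingPath_outcome hSu hSY hu hWY hSW huW huY)
  -- `Z` consists of measured covariates, so it contains neither `W` nor the latent `u`.
  · exact absurd hsep (D.not_dSep_removeEdge_of_adj hSu hSY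
      (fun h => D.W_notMem (Or.inl (hZ h).1))
      (fun h => D.disjoint_X_U.notMem_of_mem_left (hZ h).1 hu) hWS huW huY)
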